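/- An oriented graph is a directed graph without loops, multiple arcs and 2-cycles. For oriented graphs $H$ and $G$, let $N(H,G)$ be the number of vertex subsets of $G$ that induce an oriented graph isomorphic to $H$. If $H$ has $k$ vertices, its inducibility is $$I(H)=\lim_{n\to\infty}\frac{\max\{N(H,G): G \text{ an oriented graph with } |V(G)|=n\}}{\binom{n}{k}}.$$ Let $H$ be the oriented graph with vertex set $\{1,2,3,4\}$ and arcs $1\to 2$, $2\to 3$, $3\to 4$, $1\to 4$ (an orientation of the 4-cycle $C_4$). Then the limit defining $I(H)$ exists and $$I(H)=\frac{3}{16}.$$ Moreover, this value is attained asymptotically by randomly oriented balanced complete bipartite graphs: if $G_n$ is obtained from the complete bipartite graph $K_{\lfloor n/2\rfloor,\lceil n/2\rceil}$ by choosing the direction of each edge independently and uniformly at random, then for every $\varepsilon>0$, $$\lim_{n\to\infty}\Pr\left(\left|\frac{N(H,G_n)}{\binom n4}-\frac{3}{16}\right|<\varepsilon\right)=1.$$ -/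

import Mathlib

open Filter Topology

/-- An oriented graph: a digraph without loops and without 2-cycles. (Taking `u = v` in `asymm`
excludes loops; multiple arcs are excluded because `Adj` is a relation.) -/
@[ext]
structure OrientedGraph (V : Type*) extends Digraph V where
  asymm : ∀ u v, Adj u v → ¬ Adj v u

namespace OrientedGraph

/-- The oriented subgraph of `G` induced on the vertex set `s`. -/
def induce {V : Type*} (G : OrientedGraph V) (s : Set V) : OrientedGraph s where
  Adj u v := G.Adj u v
  asymm u v := G.asymm u v

/-- Isomorphisms of oriented graphs: bijections of the vertices that preserve and reflect arcs. -/
abbrev Iso {V W : Type*} (G : OrientedGraph V) (H : OrientedGraph W) : Type _ :=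
  G.Adj ≃r H.Adj

/-- The number `N(H, G)` of induced copies of `H` in the finite oriented graph `G`, that is, the
number of vertex sets of `G` that induce an oriented graph isomorphic to `H`
(such sets automatically have as many elements as `H` has vertices). -/
noncomputable def inducedCopies {W V : Type*} (H : OrientedGraph W) (G : OrientedGraph V) : ℕ :=
  Set.ncard {s : Finset V | Nonempty (Iso (G.induce (s : Set V)) H)}

/-- The induced density of `H` in `G`: the number of induced copies of `H` divided by the number
of vertex sets of the size of `H`. -/
noncomputable def inducedDensity {W V : Type*} (H : OrientedGraph W) (G : OrientedGraph V) : ℝ :=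
  (inducedCopies H G : ℝ) / ((Nat.card V).choose (Nat.card W) : ℝ)

/-- The largest number of induced copies of `H` in an oriented graph on `n` vertices. -/
noncomputable def maxInducedCopies {W : Type*} (H : OrientedGraph W) (n : ℕ) : ℕ :=
  sSup (Set.range fun G : OrientedGraph (Fin n) => inducedCopies H G)

/-- The supremum in `maxInducedCopies` is a maximum. -/
theorem isGreatest_maxInducedCopies {W : Type*} (H : OrientedGraph W) (n : ℕ) :
    IsGreatest (Set.range fun G : OrientedGraph (Fin n) => inducedCopies H G)
      (maxInducedCopies H n) := by
  have hb : BddAbove (Set.range fun G : OrientedGraph (Fin n) => inducedCopies H G) := by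
    refine ⟨Nat.card (Finset (Fin n)), ?_⟩
    rintro _ ⟨G, rfl⟩
    exact (Set.ncard_le_card _)
  exact ⟨Nat.sSup_mem ⟨_, ⟨⟨⟨fun _ _ => False⟩, fun _ _ h => h.elim⟩, rfl⟩⟩ hb,
    fun _ hx => le_csSup hb hx⟩

/-- `c` is the inducibility of `H`: the limit, as `n → ∞`, of the largest number of induced copies
of `H` in an oriented graph on `n` vertices, divided by `n.choose k`, where `k` is the number of
vertices of `H`, exists and equals `c`. -/
def IsInducibility {W : Type*} (H : OrientedGraph W) (c : ℝ) : Prop :=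
  Tendsto (fun n : ℕ => (maxInducedCopies H n : ℝ) / (n.choose (Nat.card W) : ℝ)) atTop (𝓝 c)

/-- The set of all orientations of the simple graph `G`: the oriented graphs whose underlying
undirected graph is `G`. -/
def orientations {V : Type*} (G : SimpleGraph V) : Set (OrientedGraph V) :=
  {D | D.toDigraph.toSimpleGraphInclusive = G}

/-- Every simple graph has an orientation. -/
theorem orientations_nonempty {V : Type*} (G : SimpleGraph V) : (orientations G).Nonempty := by
  classical
  let r : V → V → Prop := WellOrderingRel
  refine ⟨⟨⟨fun u v => G.Adj u v ∧ r u v⟩, fun u v h h' => asymm_of r h.2 h'.2⟩, ?_⟩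
  ext u v
  simp only [Digraph.toSimpleGraphInclusive, SimpleGraph.fromRel_adj]
  constructor
  · rintro ⟨-, h | h⟩
    exacts [h.1, h.1.symm]
  · intro h
    refine ⟨h.ne, ?_⟩
    rcases trichotomous_of r u v with h1 | h1 | h1
    exacts [Or.inl ⟨h, h1⟩, (h.ne h1).elim, Or.inr ⟨h.symm, h1⟩]

/-- The probability that the random orientation of the finite graph `G` has the property `P`.
Orienting every edge independently, each direction having probability `1/2`, gives every
orientation of `G` the same probability, so this is the proportion of the orientations of `G`
that have the property `P`. -/
noncomputable def randomOrientationProb {V : Type*} (G : SimpleGraph V)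
    (P : OrientedGraph V → Prop) : ℝ :=
  (Set.ncard {D | D ∈ orientations G ∧ P D} : ℝ) / (Set.ncard (orientations G) : ℝ)

/-- The orientation of the 4-cycle with the arcs `1 → 2 → 3 → 4` and `1 → 4`
(vertices renumbered from `0`). -/
def pathClosedC4 : OrientedGraph (Fin 4) where
  Adj u v := (u, v) ∈ ({(0, 1), (1, 2), (2, 3), (0, 3)} : Finset (Fin 4 × Fin 4))
  asymm := by decide

end OrientedGraph

/-- The balanced complete bipartite graph on `n` vertices, with parts of sizes `⌊n/2⌋`
and `n - ⌊n/2⌋ = ⌈n/2⌉`. -/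
def balancedCompleteBipartite (n : ℕ) : SimpleGraph (Fin (n / 2) ⊕ Fin (n - n / 2)) :=
  completeBipartiteGraph (Fin (n / 2)) (Fin (n - n / 2))

/-! An orientation of a 4-cycle is `pathClosedC4` exactly when the product of its signs around the
cycle is `-1`, since one backward arc and three backward arcs differ by a reflection. So the problem
is to count induced 4-cycles with negative product in a sign matrix. Each copy gives eight ordered
cycles of weight 2, so `totalSum` is at least 16 times the number of copies. The target `totalSum ≤
n ^ 4 / 8 + O(n ^ 3)` gives density `24 / 128 = 3 / 16`.

Upper bound, all degrees at least `n / 2` (`totalSum_le_of_deg_ge`). Write d and e for degree and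
non-degree, so d + e = n, and split n times the sum as Σ d·`localSum` + Σ e·`localSum`. In the first
sum the signed count around a pair of opposite vertices is a square, which leaves e·d³. In the
second, the signed part would be nonnegative, again by a sum of squares, if non-adjacency were an
equivalence relation, and the unsigned part is at most Σ e³·d. Failures of transitivity are cherries
of the complement. They cost something in the signed part but bring gains in the other two
estimates, and the degree hypothesis makes the gains win. Finally de(d² + e²) ≤ n⁴/8.

A vertex of degree below `n / 2` is deleted by induction (`IsSignMatrix.totalSum_le`): it lies in
few negative cycles, because `nondeg * deg ^ 2 ≤ n ^ 3 / 8` there.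

Lower bound and concentration: reversing one edge of a 4-cycle changes its sign, so on average at
least half of the 4-cycles of the balanced complete bipartite graph are negative
(`choose_mul_choose_mul_le`). This average agrees asymptotically with the universal upper bound, so
Markov's inequality for the deficit suffices and no variance is needed. -/

/-! ### Sign matrices and weighted counts of 4-cycles. -/

/-- An antisymmetric matrix with entries in `{-1, 0, 1}`: the signed adjacency matrix of an
oriented graph. -/
structure IsSignMatrix {V : Type*} (A : V → V → ℝ) : Prop where
  antisymm : ∀ u v, A v u = -A u v
  entries : ∀ u v, A u v = 0 ∨ A u v = 1 ∨ A u v = -1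

namespace IsSignMatrix

variable {V : Type*} {A : V → V → ℝ}

theorem sq_comm (hA : IsSignMatrix A) (u v : V) : A u v ^ 2 = A v u ^ 2 := by
  rw [hA.antisymm u v]; ring

theorem sq_le_one (hA : IsSignMatrix A) (u v : V) : A u v ^ 2 ≤ 1 := by
  rcases hA.entries u v with h | h | h <;> rw [h] <;> norm_num

theorem nonadj_nonneg (hA : IsSignMatrix A) (u v : V) : 0 ≤ 1 - A u v ^ 2 :=
  sub_nonneg.2 (hA.sq_le_one u v)

theorem nonadj_le_one (A : V → V → ℝ) (u v : V) : 1 - A u v ^ 2 ≤ 1 := by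
  have := sq_nonneg (A u v); linarith

theorem le_sq_of_entries {x : ℝ} (hx : x = 0 ∨ x = 1 ∨ x = -1) : x ≤ x ^ 2 := by
  rcases hx with h | h | h <;> rw [h] <;> norm_num

theorem entries_mul {x y : ℝ} (hx : x = 0 ∨ x = 1 ∨ x = -1) (hy : y = 0 ∨ y = 1 ∨ y = -1) :
    x * y = 0 ∨ x * y = 1 ∨ x * y = -1 := by
  rcases hx with h | h | h <;> rcases hy with h' | h' | h' <;> rw [h, h'] <;> norm_num

end IsSignMatrix

namespace SignMatrix

variable {V : Type*} (A : V → V → ℝ)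

/-- The product of the entries around the closed walk `w, u, y, v`. -/
def cyc (w y u v : V) : ℝ := A w u * A u y * (A y v * A v w)

/-- The weight `2` of a closed walk `w, u, y, v` that is an induced 4-cycle with negative product,
and `0` for all other closed walks. -/
def term (w y u v : V) : ℝ :=
  (1 - A w y ^ 2) * (1 - A u v ^ 2) * (cyc A w y u v ^ 2 - cyc A w y u v)

variable [Fintype V]

/-- The number of neighbours. -/
def deg (w : V) : ℝ := ∑ v, A w v ^ 2

/-- The number of non-neighbours, the vertex itself included. -/
def nondeg (w : V) : ℝ := ∑ v, (1 - A w v ^ 2)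

/-- The number of common neighbours. -/
def codeg (w y : V) : ℝ := ∑ u, A w u ^ 2 * A u y ^ 2

/-- The number of common non-neighbours. -/
def conondeg (w y : V) : ℝ := ∑ z, (1 - A w z ^ 2) * (1 - A z y ^ 2)

/-- The number of neighbours of `x` that are non-neighbours of `y`. -/
def diffdeg (x y : V) : ℝ := ∑ z, A x z ^ 2 * (1 - A z y ^ 2)

/-- Indicator of a cherry of the complement: an edge `a b` and a vertex `m` adjacent to
neither `a` nor `b`. -/
def cherry (m a b : V) : ℝ := (1 - A a m ^ 2) * (1 - A b m ^ 2) * A a b ^ 2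

/-- The weighted number of induced negative 4-cycles through `w`. -/
def localSum (w : V) : ℝ := ∑ y, ∑ u, ∑ v, term A w y u v

/-- The weighted number of induced negative 4-cycles. -/
def totalSum : ℝ := ∑ w, localSum A w

/-- The signed number of pairs of non-adjacent common neighbours. -/
def signedPairs (w y : V) : ℝ := ∑ u, ∑ v, (1 - A u v ^ 2) * cyc A w y u v

/-- The number of pairs of non-adjacent common neighbours. -/
def pairs (w y : V) : ℝ := ∑ u, ∑ v, (1 - A u v ^ 2) * cyc A w y u v ^ 2

end SignMatrix

/-! ### Symmetries, degree identities and cherry estimates. -/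

open SignMatrix

namespace IsSignMatrix

variable {V : Type*} {A : V → V → ℝ}

theorem cyc_entries (hA : IsSignMatrix A) (w y u v : V) :
    cyc A w y u v = 0 ∨ cyc A w y u v = 1 ∨ cyc A w y u v = -1 :=
  entries_mul (entries_mul (hA.entries _ _) (hA.entries _ _))
    (entries_mul (hA.entries _ _) (hA.entries _ _))

theorem cyc_eq (hA : IsSignMatrix A) (w y u v : V) :
    cyc A w y u v = (A w u * A u y) * (A w v * A v y) := by
  rw [cyc, hA.antisymm v y, hA.antisymm w v]; ring

theorem cyc_swap (hA : IsSignMatrix A) (w y u v : V) : cyc A w y u v = cyc A y w u v := by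
  rw [cyc, cyc, hA.antisymm w u, hA.antisymm u y, hA.antisymm v y, hA.antisymm w v]; ring

theorem cyc_rotate (hA : IsSignMatrix A) (w y u v : V) : cyc A w y u v = cyc A u v w y := by
  rw [cyc, cyc, hA.antisymm w u, hA.antisymm u y, hA.antisymm y v, hA.antisymm w v]; ring

theorem term_nonneg (hA : IsSignMatrix A) (w y u v : V) : 0 ≤ term A w y u v :=
  mul_nonneg (mul_nonneg (hA.nonadj_nonneg _ _) (hA.nonadj_nonneg _ _))
    (sub_nonneg.2 (le_sq_of_entries (hA.cyc_entries _ _ _ _)))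

theorem term_swap (hA : IsSignMatrix A) (w y u v : V) : term A w y u v = term A y w u v := by
  rw [term, term, hA.cyc_swap, hA.sq_comm w y]

theorem term_rotate (hA : IsSignMatrix A) (w y u v : V) : term A w y u v = term A u v w y := by
  rw [term, term, hA.cyc_rotate]; ring

theorem cherry_nonneg (hA : IsSignMatrix A) (m a b : V) : 0 ≤ cherry A m a b :=
  mul_nonneg (mul_nonneg (hA.nonadj_nonneg _ _) (hA.nonadj_nonneg _ _)) (sq_nonneg _)

theorem restrict (hA : IsSignMatrix A) (p : V → Prop) :
    IsSignMatrix fun u v : {x // p x} => A u v :=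
  ⟨fun _ _ => hA.antisymm _ _, fun _ _ => hA.entries _ _⟩

variable [Fintype V]

theorem deg_nonneg (A : V → V → ℝ) (w : V) : 0 ≤ deg A w := Finset.sum_nonneg fun _ _ => sq_nonneg _

theorem nondeg_nonneg (hA : IsSignMatrix A) (w : V) : 0 ≤ nondeg A w :=
  Finset.sum_nonneg fun _ _ => hA.nonadj_nonneg _ _

theorem deg_add_nondeg (A : V → V → ℝ) (w : V) : deg A w + nondeg A w = Fintype.card V := by
  rw [deg, nondeg, ← Finset.sum_add_distrib]; simp

theorem codeg_nonneg (A : V → V → ℝ) (w y : V) : 0 ≤ codeg A w y :=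
  Finset.sum_nonneg fun _ _ => by positivity

theorem codeg_le (hA : IsSignMatrix A) (w y : V) : codeg A w y ≤ deg A w :=
  Finset.sum_le_sum fun _ _ => mul_le_of_le_one_right (sq_nonneg _) (hA.sq_le_one _ _)

theorem conondeg_nonneg (hA : IsSignMatrix A) (w y : V) : 0 ≤ conondeg A w y :=
  Finset.sum_nonneg fun _ _ => mul_nonneg (hA.nonadj_nonneg _ _) (hA.nonadj_nonneg _ _)

theorem conondeg_le_left (hA : IsSignMatrix A) (w y : V) : conondeg A w y ≤ nondeg A w :=
  Finset.sum_le_sum fun _ _ => mul_le_of_le_one_right (hA.nonadj_nonneg _ _) (nonadj_le_one _ _ _)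

theorem conondeg_comm (hA : IsSignMatrix A) (w y : V) : conondeg A w y = conondeg A y w :=
  Finset.sum_congr rfl fun z _ => by rw [hA.sq_comm w z, hA.sq_comm z y]; ring

theorem conondeg_le_right (hA : IsSignMatrix A) (w y : V) : conondeg A w y ≤ nondeg A y :=
  hA.conondeg_comm w y ▸ hA.conondeg_le_left y w

theorem diffdeg_nonneg (hA : IsSignMatrix A) (x y : V) : 0 ≤ diffdeg A x y :=
  Finset.sum_nonneg fun _ _ => mul_nonneg (sq_nonneg _) (hA.nonadj_nonneg _ _)

theorem diffdeg_le (hA : IsSignMatrix A) (x y : V) : diffdeg A x y ≤ nondeg A y :=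
  Finset.sum_le_sum fun z _ => by
    rw [hA.sq_comm y z]
    exact mul_le_of_le_one_left (hA.nonadj_nonneg _ _) (hA.sq_le_one _ _)

theorem codeg_eq (A : V → V → ℝ) (w y : V) : codeg A w y = deg A w - diffdeg A w y := by
  rw [codeg, deg, diffdeg, ← Finset.sum_sub_distrib]
  exact Finset.sum_congr rfl fun _ _ => by ring

theorem conondeg_eq (hA : IsSignMatrix A) (w y : V) :
    conondeg A w y = nondeg A w - diffdeg A y w := by
  rw [conondeg, nondeg, diffdeg, ← Finset.sum_sub_distrib]
  exact Finset.sum_congr rfl fun z _ => by rw [hA.sq_comm w z, hA.sq_comm y z]; ring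

theorem signedPairs_le (hA : IsSignMatrix A) (w y : V) : signedPairs A w y ≤ pairs A w y :=
  Finset.sum_le_sum fun _ _ => Finset.sum_le_sum fun _ _ =>
    mul_le_mul_of_nonneg_left (le_sq_of_entries (hA.cyc_entries _ _ _ _)) (hA.nonadj_nonneg _ _)

theorem neg_signedPairs_le (hA : IsSignMatrix A) (w y : V) :
    -signedPairs A w y ≤ pairs A w y := by
  rw [signedPairs, pairs, ← Finset.sum_neg_distrib]
  refine Finset.sum_le_sum fun u _ => ?_
  rw [← Finset.sum_neg_distrib]
  refine Finset.sum_le_sum fun v _ => ?_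
  rw [← mul_neg]
  refine mul_le_mul_of_nonneg_left ?_ (hA.nonadj_nonneg _ _)
  rcases hA.cyc_entries w y u v with h | h | h <;> rw [h] <;> norm_num

theorem localSum_eq (A : V → V → ℝ) (w : V) :
    localSum A w = ∑ y, (1 - A w y ^ 2) * (pairs A w y - signedPairs A w y) := by
  rw [localSum]
  refine Finset.sum_congr rfl fun y _ => ?_
  rw [pairs, signedPairs, ← Finset.sum_sub_distrib, Finset.mul_sum]
  refine Finset.sum_congr rfl fun u _ => ?_
  rw [← Finset.sum_sub_distrib, Finset.mul_sum]
  exact Finset.sum_congr rfl fun v _ => by rw [term]; ring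

/-- The summands `cyc ^ 2 - cyc` are nonnegative, so the condition that `u` and `v` be non-adjacent
may be dropped. Without it the double sum of `cyc` factors as a square, which is then discarded. -/
theorem pairs_sub_signedPairs_le (hA : IsSignMatrix A) (w y : V) :
    pairs A w y - signedPairs A w y ≤ codeg A w y ^ 2 := by
  have h1 : pairs A w y - signedPairs A w y ≤
      ∑ u, ∑ v, (cyc A w y u v ^ 2 - cyc A w y u v) := by
    rw [pairs, signedPairs, ← Finset.sum_sub_distrib]
    refine Finset.sum_le_sum fun u _ => ?_
    rw [← Finset.sum_sub_distrib]
    refine Finset.sum_le_sum fun v _ => ?_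
    rw [← mul_sub]
    exact mul_le_of_le_one_left (sub_nonneg.2 (le_sq_of_entries (hA.cyc_entries _ _ _ _)))
      (nonadj_le_one _ _ _)
  have h2 : ∑ u, ∑ v, (cyc A w y u v ^ 2 - cyc A w y u v) =
      codeg A w y ^ 2 - (∑ u, A w u * A u y) ^ 2 := by
    simp only [Finset.sum_sub_distrib, hA.cyc_eq, mul_pow, codeg]
    rw [pow_two (∑ u, A w u ^ 2 * A u y ^ 2), pow_two (∑ u, A w u * A u y), Finset.sum_mul_sum,
      Finset.sum_mul_sum]
  have := sq_nonneg (∑ u, A w u * A u y)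
  linarith

theorem localSum_le_deg (hA : IsSignMatrix A) (w : V) :
    localSum A w ≤ nondeg A w * deg A w ^ 2 := by
  rw [localSum_eq, nondeg, Finset.sum_mul]
  refine Finset.sum_le_sum fun y _ => mul_le_mul_of_nonneg_left ?_ (hA.nonadj_nonneg _ _)
  exact (hA.pairs_sub_signedPairs_le w y).trans
    (pow_le_pow_left₀ (codeg_nonneg _ _ _) (hA.codeg_le _ _) 2)

theorem localSum_le_cherry (hA : IsSignMatrix A) (w : V) :
    localSum A w ≤ nondeg A w * deg A w ^ 2 -
      ∑ m, ∑ b, cherry A m w b * (2 * deg A w - nondeg A m) := by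
  rw [localSum_eq, nondeg, Finset.sum_mul, ← Finset.sum_sub_distrib]
  refine Finset.sum_le_sum fun y _ => ?_
  have h1 : ∑ b, cherry A y w b * (2 * deg A w - nondeg A y) =
      (1 - A w y ^ 2) * (diffdeg A w y * (2 * deg A w - nondeg A y)) := by
    rw [← Finset.sum_mul, diffdeg, ← mul_assoc, Finset.mul_sum]
    congr 1
    exact Finset.sum_congr rfl fun b _ => by rw [cherry]; ring
  rw [h1, ← mul_sub]
  refine mul_le_mul_of_nonneg_left ?_ (hA.nonadj_nonneg _ _)
  refine (hA.pairs_sub_signedPairs_le w y).trans ?_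
  rw [codeg_eq]
  -- With δ = `diffdeg A w y`, the term δ² in (d − δ)² is at most δ·`nondeg A y`.
  nlinarith [mul_nonneg (hA.diffdeg_nonneg w y) (sub_nonneg.2 (hA.diffdeg_le w y))]

/-- Fix a common non-neighbour `z` and the opposite pair `u`, `v`: the sums over `w` and `y`
separate into two equal factors. -/
theorem sum_conondeg_signedPairs_nonneg (hA : IsSignMatrix A) :
    0 ≤ ∑ w, ∑ y, conondeg A w y * signedPairs A w y := by
  have h : ∑ w, ∑ y, conondeg A w y * signedPairs A w y =
      ∑ z, ∑ u, ∑ v, (1 - A u v ^ 2) * (∑ w, (1 - A z w ^ 2) * (A w u * A w v)) ^ 2 := by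
    have h1 : ∀ w y, conondeg A w y * signedPairs A w y = ∑ z, ∑ u, ∑ v,
        (1 - A u v ^ 2) * ((1 - A z w ^ 2) * (A w u * A w v) *
          ((1 - A z y ^ 2) * (A y u * A y v))) := by
      intro w y
      rw [conondeg, signedPairs, Finset.sum_mul]
      refine Finset.sum_congr rfl fun z _ => ?_
      rw [Finset.mul_sum]
      refine Finset.sum_congr rfl fun u _ => ?_
      rw [Finset.mul_sum]
      refine Finset.sum_congr rfl fun v _ => ?_
      rw [hA.cyc_eq, hA.sq_comm w z, hA.antisymm y u, hA.antisymm y v]; ring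
    simp only [h1]
    calc _ = ∑ w, ∑ z, ∑ y, ∑ u, ∑ v, (1 - A u v ^ 2) * ((1 - A z w ^ 2) * (A w u * A w v) *
          ((1 - A z y ^ 2) * (A y u * A y v))) :=
          Finset.sum_congr rfl fun w _ => Finset.sum_comm
      _ = _ := by
          rw [Finset.sum_comm]
          refine Finset.sum_congr rfl fun z _ => ?_
          calc _ = ∑ w, ∑ u, ∑ v, ∑ y, (1 - A u v ^ 2) * ((1 - A z w ^ 2) * (A w u * A w v) *
                ((1 - A z y ^ 2) * (A y u * A y v))) := by
                refine Finset.sum_congr rfl fun w _ => ?_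
                rw [Finset.sum_comm]
                exact Finset.sum_congr rfl fun u _ => Finset.sum_comm
            _ = _ := by
                rw [Finset.sum_comm]
                refine Finset.sum_congr rfl fun u _ => ?_
                rw [Finset.sum_comm]
                refine Finset.sum_congr rfl fun v _ => ?_
                rw [pow_two (∑ w, _), Finset.sum_mul_sum, Finset.mul_sum]
                exact Finset.sum_congr rfl fun w _ => (Finset.mul_sum _ _ _).symm
  rw [h]
  exact Finset.sum_nonneg fun _ _ => Finset.sum_nonneg fun _ _ => Finset.sum_nonneg fun _ _ =>
    mul_nonneg (hA.nonadj_nonneg _ _) (sq_nonneg _)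

theorem pairs_le (hA : IsSignMatrix A) {r : ℝ} (hr : ∀ u, nondeg A u ≤ r) (w y : V) :
    pairs A w y ≤ r * codeg A w y := by
  rw [pairs, codeg, Finset.mul_sum]
  refine Finset.sum_le_sum fun u _ => ?_
  refine le_trans ?_ (mul_le_mul_of_nonneg_right (hr u)
    (by positivity : 0 ≤ A w u ^ 2 * A u y ^ 2))
  rw [nondeg, Finset.sum_mul]
  refine Finset.sum_le_sum fun v _ => mul_le_mul_of_nonneg_left ?_ (hA.nonadj_nonneg _ _)
  rw [hA.cyc_eq, mul_pow, mul_pow]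
  refine mul_le_of_le_one_right (by positivity) ?_
  rw [mul_pow]
  exact mul_le_one₀ (hA.sq_le_one _ _) (sq_nonneg _) (hA.sq_le_one _ _)

/-- The signed contribution, bounded by cherries. -/
theorem neg_sum_nondeg_signedPairs_le (hA : IsSignMatrix A) {r : ℝ} (hr : ∀ u, nondeg A u ≤ r) :
    -∑ w, ∑ y, nondeg A w * (1 - A w y ^ 2) * signedPairs A w y ≤
      ∑ a, ∑ m, ∑ b, cherry A m a b * (r * (deg A m + deg A a)) := by
  have hr0 : ∀ u : V, 0 ≤ r := fun u => (hA.nondeg_nonneg u).trans (hr u)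
  have h0 := hA.sum_conondeg_signedPairs_nonneg
  -- The weight `conondeg A w y` equals `nondeg A w` on non-adjacent pairs and 0 on adjacent ones,
  -- up to two corrections. Both are carried by cherries: a neighbour of `y` missed by `w`, or a
  -- common non-neighbour of an edge.
  have h1 : ∑ w, ∑ y, conondeg A w y * signedPairs A w y =
      ∑ w, ∑ y, nondeg A w * (1 - A w y ^ 2) * signedPairs A w y
      - ∑ w, ∑ y, (1 - A w y ^ 2) * diffdeg A y w * signedPairs A w y
      + ∑ w, ∑ y, A w y ^ 2 * conondeg A w y * signedPairs A w y := by
    simp only [← Finset.sum_sub_distrib, ← Finset.sum_add_distrib]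
    refine Finset.sum_congr rfl fun w _ => Finset.sum_congr rfl fun y _ => ?_
    linear_combination (1 - A w y ^ 2) * signedPairs A w y * hA.conondeg_eq w y
  have h2 : -∑ w, ∑ y, (1 - A w y ^ 2) * diffdeg A y w * signedPairs A w y ≤
      ∑ a, ∑ m, ∑ b, cherry A m a b * (r * deg A m) := by
    rw [Finset.sum_comm, ← Finset.sum_neg_distrib]
    refine Finset.sum_le_sum fun a _ => ?_
    rw [← Finset.sum_neg_distrib]
    refine Finset.sum_le_sum fun m _ => ?_
    have e : ∑ b, cherry A m a b * (r * deg A m) =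
        (1 - A m a ^ 2) * diffdeg A a m * (r * deg A m) := by
      rw [← Finset.sum_mul, diffdeg, Finset.mul_sum]
      congr 1
      exact Finset.sum_congr rfl fun b _ => by rw [cherry, hA.sq_comm m a]; ring
    rw [e, ← mul_neg]
    refine mul_le_mul_of_nonneg_left ?_ (mul_nonneg (hA.nonadj_nonneg _ _) (hA.diffdeg_nonneg _ _))
    exact (hA.neg_signedPairs_le m a).trans ((hA.pairs_le hr m a).trans
      (mul_le_mul_of_nonneg_left (hA.codeg_le _ _) (hr0 m)))
  have h3 : ∑ w, ∑ y, A w y ^ 2 * conondeg A w y * signedPairs A w y ≤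
      ∑ a, ∑ m, ∑ b, cherry A m a b * (r * deg A a) := by
    refine Finset.sum_le_sum fun a _ => ?_
    rw [Finset.sum_comm]
    refine Finset.sum_le_sum fun b _ => ?_
    have e : ∑ m, cherry A m a b * (r * deg A a) =
        A a b ^ 2 * conondeg A a b * (r * deg A a) := by
      rw [← Finset.sum_mul, conondeg, Finset.mul_sum]
      congr 1
      exact Finset.sum_congr rfl fun m _ => by rw [cherry, hA.sq_comm b m]; ring
    rw [e]
    refine mul_le_mul_of_nonneg_left ?_ (mul_nonneg (sq_nonneg _) (hA.conondeg_nonneg _ _))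
    exact (hA.signedPairs_le a b).trans ((hA.pairs_le hr a b).trans
      (mul_le_mul_of_nonneg_left (hA.codeg_le _ _) (hr0 a)))
  have h4 : ∑ a, ∑ m, ∑ b, cherry A m a b * (r * (deg A m + deg A a)) =
      ∑ a, ∑ m, ∑ b, cherry A m a b * (r * deg A m) +
      ∑ a, ∑ m, ∑ b, cherry A m a b * (r * deg A a) := by
    simp only [← Finset.sum_add_distrib]
    refine Finset.sum_congr rfl fun _ _ => Finset.sum_congr rfl fun _ _ =>
      Finset.sum_congr rfl fun _ _ => by ring
  linarith

/-- Regroup the cycles by the edge `w u`. Then `y` is a non-neighbour of `w` adjacent to `u`, and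
`v` a non-neighbour of `u` adjacent to `w`. Forgetting the edge `v y` makes the two choices
independent. -/
theorem sum_nondeg_pairs_le_sum_edges (hA : IsSignMatrix A) :
    ∑ w, ∑ y, nondeg A w * (1 - A w y ^ 2) * pairs A w y ≤
      ∑ w, ∑ u, A w u ^ 2 * (nondeg A w *
        ((nondeg A w - conondeg A w u) * (nondeg A u - conondeg A w u))) := by
  refine Finset.sum_le_sum fun w _ => ?_
  simp only [pairs, Finset.mul_sum]
  rw [Finset.sum_comm]
  refine Finset.sum_le_sum fun u _ => ?_
  have h1 : nondeg A w - conondeg A w u = ∑ y, (1 - A w y ^ 2) * A u y ^ 2 := by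
    rw [nondeg, conondeg, ← Finset.sum_sub_distrib]
    exact Finset.sum_congr rfl fun y _ => by rw [hA.sq_comm y u]; ring
  have h2 : nondeg A u - conondeg A w u = ∑ v, (1 - A u v ^ 2) * A w v ^ 2 := by
    rw [nondeg, conondeg, ← Finset.sum_sub_distrib]
    exact Finset.sum_congr rfl fun v _ => by rw [hA.sq_comm v u]; ring
  rw [h1, h2, Finset.sum_mul_sum, Finset.mul_sum, Finset.mul_sum]
  refine Finset.sum_le_sum fun y _ => ?_
  rw [Finset.mul_sum, Finset.mul_sum]
  refine Finset.sum_le_sum fun v _ => ?_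
  have h3 : 0 ≤ nondeg A w * (1 - A w y ^ 2) * (1 - A u v ^ 2) * A w u ^ 2 * A u y ^ 2 *
      A w v ^ 2 := by
    have := hA.nondeg_nonneg w
    have := hA.nonadj_nonneg w y
    have := hA.nonadj_nonneg u v
    positivity
  calc _ = nondeg A w * (1 - A w y ^ 2) * (1 - A u v ^ 2) * A w u ^ 2 * A u y ^ 2 *
      A w v ^ 2 * A v y ^ 2 := by rw [hA.cyc_eq]; ring
    _ ≤ _ := mul_le_of_le_one_right h3 (hA.sq_le_one _ _)
    _ = _ := by ring

/-- The difference of the two sides is (p + q)(p − q)² + k(2pq − k(p + q)), and `k ≤ min p q` makes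
the second term nonnegative. -/
theorem mul_sub_mul_sub_le {p q k : ℝ} (hp : 0 ≤ p) (hq : 0 ≤ q) (hk : 0 ≤ k) (hkp : k ≤ p)
    (hkq : k ≤ q) :
    (p + q) * ((p - k) * (q - k)) ≤ p ^ 3 + q ^ 3 - k * (p ^ 2 + q ^ 2) := by
  have h1 : k * (k * (p + q)) ≤ k * (2 * (p * q)) := by
    refine mul_le_mul_of_nonneg_left ?_ hk
    nlinarith [mul_le_mul_of_nonneg_right hkp hq, mul_le_mul_of_nonneg_right hkq hp]
  nlinarith [mul_nonneg (add_nonneg hp hq) (sq_nonneg (p - q))]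

/-- The unsigned contribution, with a gain for each cherry. -/
theorem sum_nondeg_pairs_le (hA : IsSignMatrix A) :
    ∑ w, ∑ y, nondeg A w * (1 - A w y ^ 2) * pairs A w y ≤
      ∑ w, nondeg A w ^ 3 * deg A w - ∑ a, ∑ m, ∑ b, cherry A m a b * nondeg A a ^ 2 := by
  refine hA.sum_nondeg_pairs_le_sum_edges.trans ?_
  set F : V → V → ℝ := fun w u => A w u ^ 2 * (nondeg A w *
        ((nondeg A w - conondeg A w u) * (nondeg A u - conondeg A w u))) with hF
  set K : V → V → ℝ := fun w u =>
    A w u ^ 2 * (nondeg A w ^ 3 - conondeg A w u * nondeg A w ^ 2) with hK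
  have hK' : ∑ w, ∑ u, K w u =
      ∑ w, nondeg A w ^ 3 * deg A w - ∑ a, ∑ m, ∑ b, cherry A m a b * nondeg A a ^ 2 := by
    rw [← Finset.sum_sub_distrib]
    refine Finset.sum_congr rfl fun w _ => ?_
    rw [Finset.sum_comm, deg, Finset.mul_sum, ← Finset.sum_sub_distrib]
    refine Finset.sum_congr rfl fun u _ => ?_
    have e : ∑ m, cherry A m w u * nondeg A w ^ 2 =
        A w u ^ 2 * conondeg A w u * nondeg A w ^ 2 := by
      rw [← Finset.sum_mul, conondeg, Finset.mul_sum]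
      congr 1
      exact Finset.sum_congr rfl fun m _ => by rw [cherry, hA.sq_comm u m]; ring
    rw [e, hK]; ring
  rw [← hK']
  -- The edge bound holds only after adding the two orders of the endpoints.
  have key : ∑ w, ∑ u, (F w u + F u w) ≤ ∑ w, ∑ u, (K w u + K u w) := by
    refine Finset.sum_le_sum fun w _ => Finset.sum_le_sum fun u _ => ?_
    have := mul_le_mul_of_nonneg_left (mul_sub_mul_sub_le (hA.nondeg_nonneg w) (hA.nondeg_nonneg u)
      (hA.conondeg_nonneg w u) (hA.conondeg_le_left w u) (hA.conondeg_le_right w u))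
      (sq_nonneg (A w u))
    simp only [hF, hK, hA.sq_comm u w, hA.conondeg_comm u w]
    linarith
  have swap : ∀ G : V → V → ℝ, ∑ w, ∑ u, (G w u + G u w) = 2 * ∑ w, ∑ u, G w u := by
    intro G
    simp only [Finset.sum_add_distrib]
    rw [Finset.sum_comm (f := fun w u => G u w)]; ring
  rw [swap, swap] at key
  linarith

/-! ### The bound on the weighted count, by minimum degree and induction. -/

theorem totalSum_le_of_deg_ge (hA : IsSignMatrix A)
    (h : ∀ w, (Fintype.card V : ℝ) / 2 ≤ deg A w) :
    totalSum A ≤ (Fintype.card V : ℝ) ^ 4 / 8 := by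
  rcases isEmpty_or_nonempty V with hV | hV
  · simp [totalSum]
  set n : ℝ := (Fintype.card V : ℝ) with hn
  have hn0 : 0 < n := by rw [hn]; exact_mod_cast Fintype.card_pos
  have hdb : ∀ w, nondeg A w = n - deg A w := fun w => by
    rw [hn, ← deg_add_nondeg A w]; ring
  have h1 : ∑ w, deg A w * localSum A w ≤ ∑ w, nondeg A w * deg A w ^ 3 -
      ∑ a, ∑ m, ∑ b, cherry A m a b * (deg A a * (2 * deg A a - nondeg A m)) := by
    rw [← Finset.sum_sub_distrib]
    refine Finset.sum_le_sum fun w _ => ?_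
    refine (mul_le_mul_of_nonneg_left (hA.localSum_le_cherry w) (deg_nonneg A w)).trans_eq ?_
    rw [mul_sub, Finset.mul_sum]
    congr 1
    · ring
    refine Finset.sum_congr rfl fun m _ => ?_
    rw [Finset.mul_sum]
    exact Finset.sum_congr rfl fun b _ => by ring
  have h2 : ∑ w, nondeg A w * localSum A w =
      ∑ w, ∑ y, nondeg A w * (1 - A w y ^ 2) * pairs A w y -
      ∑ w, ∑ y, nondeg A w * (1 - A w y ^ 2) * signedPairs A w y := by
    rw [← Finset.sum_sub_distrib]
    refine Finset.sum_congr rfl fun w _ => ?_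
    rw [localSum_eq, Finset.mul_sum, ← Finset.sum_sub_distrib]
    exact Finset.sum_congr rfl fun y _ => by ring
  have h3 := hA.sum_nondeg_pairs_le
  have h4 := hA.neg_sum_nondeg_signedPairs_le (r := n / 2) fun u => by rw [hdb]; linarith [h u]
  have h5 : ∑ w, deg A w * localSum A w + ∑ w, nondeg A w * localSum A w = n * totalSum A := by
    rw [← Finset.sum_add_distrib, totalSum, Finset.mul_sum]
    exact Finset.sum_congr rfl fun w _ => by rw [hdb]; ring
  -- The cherry balance. With x = `deg A a - n / 2` and y = `deg A m - n / 2`, gain minus loss per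
  -- cherry is 3x² + xy, nonnegative by the degree hypothesis.
  have h6 : ∑ a, ∑ m, ∑ b, cherry A m a b * (n / 2 * (deg A m + deg A a)) ≤
      ∑ a, ∑ m, ∑ b, cherry A m a b * (deg A a * (2 * deg A a - nondeg A m)) +
      ∑ a, ∑ m, ∑ b, cherry A m a b * nondeg A a ^ 2 := by
    simp only [← Finset.sum_add_distrib, ← mul_add]
    refine Finset.sum_le_sum fun a _ => Finset.sum_le_sum fun m _ => Finset.sum_le_sum fun b _ =>
      mul_le_mul_of_nonneg_left ?_ (hA.cherry_nonneg m a b)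
    rw [hdb, hdb]
    nlinarith [mul_nonneg (sub_nonneg.2 (h a)) (sub_nonneg.2 (h m)),
      mul_nonneg (sub_nonneg.2 (h a)) (sub_nonneg.2 (h a))]
  -- With p = de, each summand is p(n² − 2p) = n⁴/8 − 2(p − n²/4)².
  have h7 : ∑ w, nondeg A w * deg A w ^ 3 + ∑ w, nondeg A w ^ 3 * deg A w ≤ n * (n ^ 4 / 8) := by
    rw [← Finset.sum_add_distrib]
    refine (Finset.sum_le_card_nsmul _ _ (n ^ 4 / 8) fun w _ => ?_).trans_eq ?_
    · rw [hdb]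
      nlinarith [sq_nonneg (deg A w * (n - deg A w) - n ^ 2 / 4)]
    · rw [nsmul_eq_mul, Finset.card_univ]
  have h8 : n * totalSum A ≤ n * (n ^ 4 / 8) := by linarith
  exact le_of_mul_le_mul_left h8 hn0

/-- A closed walk either avoids `x` or has it in one of four positions. The symmetries of the cycle
move any position to the first, so each costs at most `localSum A x`. -/
theorem totalSum_le_restrict_add [DecidableEq V] (hA : IsSignMatrix A) (x : V) :
    totalSum A ≤ totalSum (fun u v : {z // z ≠ x} => A u v) + 4 * localSum A x := by
  have sub_le : ∀ f : V → ℝ, (∀ z, 0 ≤ f z) → ∑ z : {z // z ≠ x}, f z ≤ ∑ z, f z := by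
    intro f hf
    rw [Fintype.sum_eq_add_sum_subtype_ne f x]
    linarith [hf x]
  have hT := hA.term_nonneg
  have nn1 : ∀ w y u, 0 ≤ ∑ v, term A w y u v := fun _ _ _ => Finset.sum_nonneg fun _ _ => hT _ _ _ _
  have nn2 : ∀ w y, 0 ≤ ∑ u, ∑ v, term A w y u v := fun _ _ => Finset.sum_nonneg fun _ _ => nn1 _ _ _
  have p2 : ∑ w : {z // z ≠ x}, ∑ u, ∑ v, term A w x u v ≤ localSum A x := by
    refine (sub_le (fun w => ∑ u, ∑ v, term A w x u v) fun w => nn2 _ _).trans_eq ?_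
    exact Finset.sum_congr rfl fun w _ => Finset.sum_congr rfl fun u _ =>
      Finset.sum_congr rfl fun v _ => hA.term_swap _ _ _ _
  have p3 : ∑ w : {z // z ≠ x}, ∑ y : {z // z ≠ x}, ∑ v, term A w y x v ≤ localSum A x := by
    calc _ ≤ ∑ w : {z // z ≠ x}, ∑ y, ∑ v, term A w y x v :=
          Finset.sum_le_sum fun w _ => sub_le (fun y => ∑ v, term A w y x v) fun y => nn1 _ _ _
      _ ≤ ∑ w, ∑ y, ∑ v, term A w y x v :=
          sub_le (fun w => ∑ y, ∑ v, term A w y x v) fun w => Finset.sum_nonneg fun y _ => nn1 _ _ _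
      _ = ∑ w, ∑ y, ∑ v, term A x v w y := by
          simp only [hA.term_rotate _ _ x]
      _ = ∑ w, ∑ v, ∑ y, term A x v w y := Finset.sum_congr rfl fun w _ => Finset.sum_comm
      _ = _ := Finset.sum_comm
  have p4 : ∑ w : {z // z ≠ x}, ∑ y : {z // z ≠ x}, ∑ u : {z // z ≠ x}, term A w y u x ≤
      localSum A x := by
    calc _ ≤ ∑ w : {z // z ≠ x}, ∑ y : {z // z ≠ x}, ∑ u, term A w y u x :=
          Finset.sum_le_sum fun w _ => Finset.sum_le_sum fun y _ =>
            sub_le (fun u => term A w y u x) fun u => hT _ _ _ _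
      _ ≤ ∑ w : {z // z ≠ x}, ∑ y, ∑ u, term A w y u x :=
          Finset.sum_le_sum fun w _ => sub_le (fun y => ∑ u, term A w y u x) fun y =>
            Finset.sum_nonneg fun u _ => hT _ _ _ _
      _ ≤ ∑ w, ∑ y, ∑ u, term A w y u x :=
          sub_le (fun w => ∑ y, ∑ u, term A w y u x) fun w => Finset.sum_nonneg fun y _ =>
            Finset.sum_nonneg fun u _ => hT _ _ _ _
      _ = ∑ w, ∑ y, ∑ u, term A x u w y :=
          Finset.sum_congr rfl fun w _ => Finset.sum_congr rfl fun y _ =>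
            Finset.sum_congr rfl fun u _ => by rw [hA.term_rotate, hA.term_swap]
      _ = ∑ w, ∑ u, ∑ y, term A x u w y := Finset.sum_congr rfl fun w _ => Finset.sum_comm
      _ = _ := Finset.sum_comm
  have e : totalSum A = localSum A x + (∑ w : {z // z ≠ x}, ∑ u, ∑ v, term A w x u v +
      (∑ w : {z // z ≠ x}, ∑ y : {z // z ≠ x}, ∑ v, term A w y x v +
      (∑ w : {z // z ≠ x}, ∑ y : {z // z ≠ x}, ∑ u : {z // z ≠ x}, term A w y u x +
      totalSum (fun u v : {z // z ≠ x} => A u v)))) := by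
    rw [totalSum, Fintype.sum_eq_add_sum_subtype_ne _ x]
    simp only [totalSum, localSum, ← Finset.sum_add_distrib]
    congr 1
    refine Finset.sum_congr rfl fun w _ => ?_
    rw [Fintype.sum_eq_add_sum_subtype_ne _ x]
    congr 1
    refine Finset.sum_congr rfl fun y _ => ?_
    rw [Fintype.sum_eq_add_sum_subtype_ne _ x]
    congr 1
    refine Finset.sum_congr rfl fun u _ => ?_
    rw [Fintype.sum_eq_add_sum_subtype_ne _ x]
    rfl
  linarith

end IsSignMatrix

/-- The weighted number of induced negative 4-cycles is at most `n ^ 2 * (n + 1) ^ 2 / 8`. -/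
theorem IsSignMatrix.totalSum_le (n : ℕ) : ∀ {V : Type*} [Fintype V] {A : V → V → ℝ},
    IsSignMatrix A → Fintype.card V = n → totalSum A ≤ (n : ℝ) ^ 2 * (n + 1) ^ 2 / 8 := by
  induction n with
  | zero =>
    intro V _ A _ hV
    have := Fintype.card_eq_zero_iff.1 hV
    simp [totalSum]
  | succ n ih =>
    intro V _ A hA hV
    classical
    have hn : (Fintype.card V : ℝ) = n + 1 := by rw [hV]; push_cast; ring
    have hn0 : (0 : ℝ) ≤ n := n.cast_nonneg
    by_cases h : ∀ w, (Fintype.card V : ℝ) / 2 ≤ deg A w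
    · refine (hA.totalSum_le_of_deg_ge h).trans ?_
      rw [hn]
      push_cast
      nlinarith [pow_nonneg hn0 2, pow_nonneg hn0 3]
    · push Not at h
      obtain ⟨x, hx⟩ := h
      have h1 := hA.totalSum_le_restrict_add x
      have h2 := ih (hA.restrict (· ≠ x)) (by
        rw [Fintype.card_subtype_compl, Fintype.card_subtype_eq, hV]; rfl)
      have h3 := hA.localSum_le_deg x
      have h4 := deg_add_nondeg A x
      have h5 := deg_nonneg A x
      rw [hn] at h4 hx
      -- On `[0, N / 2]`, with N = `n + 1`, the function (N − d)d² increases, and its value at N/2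
      -- is N³/8.
      have h6 : nondeg A x * deg A x ^ 2 ≤ (n + 1 : ℝ) ^ 3 / 8 := by
        have e : nondeg A x = n + 1 - deg A x := by linarith
        rw [e]
        have h7 : 0 ≤ (n + 1) / 2 - deg A x := by linarith
        nlinarith [mul_nonneg h7 (mul_nonneg h7 h5), mul_nonneg h7 (sq_nonneg (n + 1 : ℝ)),
          mul_nonneg h7 (mul_nonneg h7 h7), mul_nonneg h7 (mul_nonneg h5 h5),
          mul_nonneg h7 (mul_nonneg h5 (by linarith : (0 : ℝ) ≤ n + 1))]
      -- The induction closes exactly: `n ^ 2 * (n + 1) ^ 2 / 8 + 4 * (n + 1) ^ 3 / 8 = (n + 1) ^ 2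
      -- * (n + 2) ^ 2 / 8`.
      push_cast
      nlinarith

/-! ### Induced copies as negative 4-cycles. -/

namespace OrientedGraph

open scoped Classical in
/-- The entry `1` for an arc, `-1` for a reversed arc and `0` for a non-adjacent pair. -/
noncomputable def sign {V : Type*} (G : OrientedGraph V) (u v : V) : ℤ :=
  if G.Adj u v then 1 else if G.Adj v u then -1 else 0

section sign

variable {V : Type*} (G : OrientedGraph V)

theorem sign_swap (u v : V) : G.sign v u = -G.sign u v := by
  have := G.asymm u v
  unfold sign
  split_ifs <;> simp_all

theorem sign_entries (u v : V) : G.sign u v = 0 ∨ G.sign u v = 1 ∨ G.sign u v = -1 := by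
  unfold sign
  split_ifs <;> simp

theorem sign_eq_one_iff {u v : V} : G.sign u v = 1 ↔ G.Adj u v := by
  unfold sign
  split_ifs <;> simp_all

theorem sign_eq_neg_one_iff {u v : V} : G.sign u v = -1 ↔ G.Adj v u := by
  rw [← G.sign_eq_one_iff, G.sign_swap u v]
  constructor <;> intro h <;> omega

theorem sign_eq_zero_iff {u v : V} : G.sign u v = 0 ↔ ¬ G.Adj u v ∧ ¬ G.Adj v u := by
  rw [← G.sign_eq_one_iff, ← G.sign_eq_neg_one_iff]
  have := G.sign_entries u v
  omega

theorem sign_self (u : V) : G.sign u u = 0 := by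
  have := G.sign_swap u u
  omega

theorem isSignMatrix_sign : IsSignMatrix fun u v => (G.sign u v : ℝ) where
  antisymm u v := by rw [G.sign_swap u v]; push_cast; rfl
  entries u v := by rcases G.sign_entries u v with h | h | h <;> simp [h]

end sign

/-- The four vertices `t 0, t 1, t 2, t 3` span an induced 4-cycle, in this cyclic order, with an
odd number of arcs against the order. -/
def IsNegativeCycle {V : Type*} (G : OrientedGraph V) (t : Fin 4 → V) : Prop :=
  G.sign (t 0) (t 2) = 0 ∧ G.sign (t 1) (t 3) = 0 ∧
    G.sign (t 0) (t 1) * G.sign (t 1) (t 2) * (G.sign (t 2) (t 3) * G.sign (t 3) (t 0)) = -1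

/-- The symmetries of the 4-cycle on `Fin 4`. -/
def cycleSymmetries : Finset (Equiv.Perm (Fin 4)) :=
  Finset.univ.filter fun σ => ∀ i, σ (i + 2) = σ i + 2

theorem card_cycleSymmetries : cycleSymmetries.card = 8 := by decide

/-- The signs of `pathClosedC4`. -/
def pathClosedC4Sign (i j : Fin 4) : ℤ :=
  if (i, j) ∈ ({(0, 1), (1, 2), (2, 3), (0, 3)} : Finset (Fin 4 × Fin 4)) then 1
  else if (j, i) ∈ ({(0, 1), (1, 2), (2, 3), (0, 3)} : Finset (Fin 4 × Fin 4)) then -1 else 0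

theorem sign_pathClosedC4 (i j : Fin 4) : pathClosedC4.sign i j = pathClosedC4Sign i j := by
  unfold sign pathClosedC4Sign pathClosedC4
  congr

/-- A rotation permutes the four factors; a reflection also negates all four, an even number. The
product is unchanged. -/
theorem isNegativeCycle_symmetry : ∀ σ ∈ cycleSymmetries,
    pathClosedC4Sign (σ 0) (σ 2) = 0 ∧ pathClosedC4Sign (σ 1) (σ 3) = 0 ∧
    pathClosedC4Sign (σ 0) (σ 1) * pathClosedC4Sign (σ 1) (σ 2) *
      (pathClosedC4Sign (σ 2) (σ 3) * pathClosedC4Sign (σ 3) (σ 0)) = -1 := by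
  decide

theorem inducedCopies_eq_card {V W : Type*} [Fintype V] (H : OrientedGraph W)
    (G : OrientedGraph V) :
    inducedCopies H G = Nat.card {s : Finset V // Nonempty (Iso (G.induce (s : Set V)) H)} := rfl

theorem exists_embedding {V W : Type*} {H : OrientedGraph W} {G : OrientedGraph V} {s : Finset V}
    (h : Nonempty (Iso (G.induce (s : Set V)) H)) :
    ∃ f : W → V, Function.Injective f ∧ Set.range f = s ∧ ∀ i j, G.Adj (f i) (f j) ↔ H.Adj i j := by
  obtain ⟨e⟩ := h
  refine ⟨fun i => (e.symm i : V), fun i j hij => ?_, ?_, fun i j => ?_⟩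
  · exact e.symm.injective (Subtype.ext hij)
  · ext x
    constructor
    · rintro ⟨i, rfl⟩
      exact (e.symm i).2
    · intro hx
      exact ⟨e ⟨x, hx⟩, by simp⟩
  · exact e.symm.map_rel_iff

theorem nonempty_iso_of_embedding {V W : Type*} {H : OrientedGraph W} {G : OrientedGraph V}
    {s : Set V} (f : W → V) (hf : Function.Injective f) (hs : Set.range f = s)
    (h : ∀ i j, G.Adj (f i) (f j) ↔ H.Adj i j) : Nonempty (Iso (G.induce s) H) := by
  subst hs
  refine ⟨(RelIso.symm ⟨Equiv.ofInjective f hf, ?_⟩)⟩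
  intro i j
  exact h i j

open scoped Classical in
/-- Every induced copy gives eight negative cycles. -/
theorem eight_mul_inducedCopies_le {V : Type*} [Fintype V] (G : OrientedGraph V) :
    8 * inducedCopies pathClosedC4 G ≤ (Finset.univ.filter G.IsNegativeCycle).card := by
  rw [inducedCopies_eq_card, Nat.card_eq_fintype_card, mul_comm, ← card_cycleSymmetries,
    ← Finset.card_univ, ← Finset.card_product]
  choose f hf hr ha using fun s : {s : Finset V //
    Nonempty (Iso (G.induce (s : Set V)) pathClosedC4)} => exists_embedding s.2
  have hsign : ∀ s i j, G.sign (f s i) (f s j) = pathClosedC4Sign i j := by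
    intro s i j
    rw [← sign_pathClosedC4]
    simp only [sign, ha]
  refine Finset.card_le_card_of_injOn (fun p => f p.1 ∘ p.2) ?_ ?_
  · rintro ⟨s, σ⟩ hp
    have := isNegativeCycle_symmetry σ (by simpa using hp)
    simpa [IsNegativeCycle, hsign] using this
  -- The range of the cycle recovers the vertex set, and then injectivity of the embedding recovers
  -- the symmetry.
  · rintro ⟨s, σ⟩ - ⟨s', σ'⟩ - h
    have h1 : s = s' := by
      apply Subtype.ext
      rw [← Finset.coe_inj, ← hr, ← hr, ← σ.surjective.range_comp (f s),
        ← σ'.surjective.range_comp (f s')]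
      exact congrArg Set.range h
    subst h1
    congr 1
    ext i
    exact congrArg _ (hf s (congrFun h i))

theorem sixteen_mul_inducedCopies_le {V : Type*} [Fintype V] (G : OrientedGraph V) :
    16 * (inducedCopies pathClosedC4 G : ℝ) ≤
      SignMatrix.totalSum fun u v => (G.sign u v : ℝ) := by
  classical
  set A : V → V → ℝ := fun u v => (G.sign u v : ℝ) with hA
  have h1 : SignMatrix.totalSum A =
      ∑ p : V × V × V × V, SignMatrix.term A p.1 p.2.1 p.2.2.1 p.2.2.2 := by
    simp only [Fintype.sum_prod_type]
    rfl
  have h2 : ∑ t ∈ Finset.univ.filter G.IsNegativeCycle, (2 : ℝ) ≤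
      ∑ p : V × V × V × V, SignMatrix.term A p.1 p.2.1 p.2.2.1 p.2.2.2 := by
    let g : (Fin 4 → V) → V × V × V × V := fun t => (t 0, t 2, t 1, t 3)
    have hg : Function.Injective g := by
      intro t t' h
      simp only [g, Prod.mk.injEq] at h
      ext i
      fin_cases i <;> tauto
    calc _ = ∑ t ∈ Finset.univ.filter G.IsNegativeCycle,
          SignMatrix.term A (g t).1 (g t).2.1 (g t).2.2.1 (g t).2.2.2 := by
          refine Finset.sum_congr rfl fun t ht => ?_
          obtain ⟨h0, h1, h2⟩ := (Finset.mem_filter.1 ht).2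
          have h3 : SignMatrix.cyc A (t 0) (t 2) (t 1) (t 3) = -1 := by
            simp only [SignMatrix.cyc, hA]
            exact_mod_cast h2
          simp only [SignMatrix.term, g, h3]
          simp only [hA, h0, h1]
          norm_num
      _ = ∑ p ∈ (Finset.univ.filter G.IsNegativeCycle).image g,
          SignMatrix.term A p.1 p.2.1 p.2.2.1 p.2.2.2 :=
          (Finset.sum_image (f := fun p : V × V × V × V =>
            SignMatrix.term A p.1 p.2.1 p.2.2.1 p.2.2.2) fun _ _ _ _ h => hg h).symm
      _ ≤ _ := Finset.sum_le_sum_of_subset_of_nonneg (Finset.subset_univ _)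
          fun _ _ _ => G.isSignMatrix_sign.term_nonneg _ _ _ _
  have h3 : (8 * inducedCopies pathClosedC4 G : ℝ) ≤
      ((Finset.univ.filter G.IsNegativeCycle).card : ℝ) := by
    exact_mod_cast G.eight_mul_inducedCopies_le
  rw [Finset.sum_const, nsmul_eq_mul] at h2
  linarith

/-- The number of induced copies of `pathClosedC4` is at most `n ^ 2 * (n + 1) ^ 2 / 128`. -/
theorem inducedCopies_pathClosedC4_le {V : Type*} [Fintype V] (G : OrientedGraph V) :
    (inducedCopies pathClosedC4 G : ℝ) ≤
      (Fintype.card V : ℝ) ^ 2 * (Fintype.card V + 1) ^ 2 / 128 := by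
  have h1 := G.sixteen_mul_inducedCopies_le
  have h2 := IsSignMatrix.totalSum_le _ G.isSignMatrix_sign rfl
  linarith

/-- Consecutive vertices differ because a zero sign would kill the product; only the diagonals need
a hypothesis. -/
theorem IsNegativeCycle.injective {V : Type*} {G : OrientedGraph V} {t : Fin 4 → V}
    (h : G.IsNegativeCycle t) (h02 : t 0 ≠ t 2) (h13 : t 1 ≠ t 3) : Function.Injective t := by
  obtain ⟨-, -, h⟩ := h
  have e : ∀ i j, t i = t j → G.sign (t i) (t j) = 0 := fun i j h => by rw [h, G.sign_self]
  have h01 : t 0 ≠ t 1 := fun h' => by simp [e _ _ h'] at h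
  have h12 : t 1 ≠ t 2 := fun h' => by simp [e _ _ h'] at h
  have h23 : t 2 ≠ t 3 := fun h' => by simp [e _ _ h'] at h
  have h30 : t 3 ≠ t 0 := fun h' => by simp [e _ _ h'] at h
  intro i j hij
  fin_cases i <;> fin_cases j <;> first | rfl | (exfalso; simp_all)

theorem nonempty_iso_of_path {V : Type*} {G : OrientedGraph V} {s : Set V} (t : Fin 4 → V)
    (ht : Function.Injective t) (hs : Set.range t = s) (h02 : G.sign (t 0) (t 2) = 0)
    (h13 : G.sign (t 1) (t 3) = 0) (h01 : G.sign (t 0) (t 1) = 1) (h12 : G.sign (t 1) (t 2) = 1)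
    (h23 : G.sign (t 2) (t 3) = 1) (h30 : G.sign (t 3) (t 0) = -1) :
    Nonempty (Iso (G.induce s) pathClosedC4) := by
  refine nonempty_iso_of_embedding t ht hs fun i j => ?_
  have h : ∀ i j, G.sign (t i) (t j) = pathClosedC4Sign i j := by
    have hd : ∀ i, pathClosedC4Sign i i = 0 := by decide
    have hsw : ∀ i j, pathClosedC4Sign i j = -pathClosedC4Sign j i := by decide
    have key : ∀ i j, i < j → G.sign (t i) (t j) = pathClosedC4Sign i j := by
      rw [G.sign_swap (t 0) (t 3)] at h30
      intro i j hij
      fin_cases i <;> fin_cases j <;> first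
        | exact absurd hij (by decide)
        | exact h01
        | exact h12
        | exact h23
        | exact h02
        | exact h13
        | exact neg_injective h30
    intro i j
    rcases lt_trichotomy i j with h | h | h
    · exact key i j h
    · rw [h, G.sign_self, hd]
    · rw [G.sign_swap (t j) (t i), hsw, key j i h]
  rw [← G.sign_eq_one_iff, h, ← sign_pathClosedC4, sign_eq_one_iff]

/-- A negative cycle induces a copy of `pathClosedC4`. -/
theorem IsNegativeCycle.nonempty_iso {V : Type*} {G : OrientedGraph V} {t : Fin 4 → V}
    (h : G.IsNegativeCycle t) (ht : Function.Injective t) :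
    Nonempty (Iso (G.induce (Set.range t)) pathClosedC4) := by
  have H : ∀ σ : Equiv.Perm (Fin 4), G.sign (t (σ 0)) (t (σ 2)) = 0 →
      G.sign (t (σ 1)) (t (σ 3)) = 0 → G.sign (t (σ 0)) (t (σ 1)) = 1 →
      G.sign (t (σ 1)) (t (σ 2)) = 1 → G.sign (t (σ 2)) (t (σ 3)) = 1 →
      G.sign (t (σ 3)) (t (σ 0)) = -1 →
      Nonempty (Iso (G.induce (Set.range t)) pathClosedC4) := fun σ a b c d e f =>
    nonempty_iso_of_path (t ∘ σ) (ht.comp σ.injective) (σ.surjective.range_comp t) a b c d e f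
  obtain ⟨h02, h13, hp⟩ := h
  have h20 := G.sign_swap (t 0) (t 2)
  have h31 := G.sign_swap (t 1) (t 3)
  have h10 := G.sign_swap (t 0) (t 1)
  have h21 := G.sign_swap (t 1) (t 2)
  have h32 := G.sign_swap (t 2) (t 3)
  have h03 := G.sign_swap (t 3) (t 0)
  -- Rotations put a single backward arc last; a reflection first turns three backward arcs into
  -- one.
  let rot : Equiv.Perm (Fin 4) := Equiv.addRight 1
  let ref : Equiv.Perm (Fin 4) := Equiv.subLeft 0
  have e0 : rot 0 = 1 := by decide
  have e1 : rot 1 = 2 := by decide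
  have e2 : rot 2 = 3 := by decide
  have e3 : rot 3 = 0 := by decide
  have f0 : ref 0 = 0 := by decide
  have f1 : ref 1 = 3 := by decide
  have f2 : ref 2 = 2 := by decide
  have f3 : ref 3 = 1 := by decide
  have H0 := H (Equiv.refl _)
  have H1 := H rot
  have H2 := H (rot * rot)
  have H3 := H (rot * rot * rot)
  have K0 := H ref
  have K1 := H (rot * ref)
  have K2 := H (rot * rot * ref)
  have K3 := H (rot * rot * rot * ref)
  simp only [Equiv.Perm.mul_apply, Equiv.refl_apply, e0, e1, e2, e3, f0, f1, f2, f3]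
    at H0 H1 H2 H3 K0 K1 K2 K3
  rcases G.sign_entries (t 0) (t 1) with h1 | h1 | h1 <;>
  rcases G.sign_entries (t 1) (t 2) with h2 | h2 | h2 <;>
  rcases G.sign_entries (t 2) (t 3) with h3 | h3 | h3 <;>
  rcases G.sign_entries (t 3) (t 0) with h4 | h4 | h4 <;>
  simp_all

end OrientedGraph

/-! ### Reversing an arc, and the average over orientations of a complete bipartite graph. -/

namespace OrientedGraph

instance instFiniteOrientedGraph {V : Type*} [Finite V] : Finite (OrientedGraph V) :=
  Finite.of_injective (fun G : OrientedGraph V => G.Adj) fun _ _ h =>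
    OrientedGraph.ext h

/-- Reverse the arc between `x` and `y`, if there is one. -/
def flip {V : Type*} (D : OrientedGraph V) (x y : V) : OrientedGraph V where
  Adj u v := (((u = x ∧ v = y) ∨ (u = y ∧ v = x)) ∧ D.Adj v u) ∨
    (¬ ((u = x ∧ v = y) ∨ (u = y ∧ v = x)) ∧ D.Adj u v)
  asymm u v := by
    have := D.asymm u v
    have := D.asymm v u
    tauto

section flip

variable {V : Type*} (D : OrientedGraph V) (x y : V)

theorem flip_adj_of_ne {u v : V} (h : ¬ ((u = x ∧ v = y) ∨ (u = y ∧ v = x))) :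
    (D.flip x y).Adj u v ↔ D.Adj u v := by
  simp only [flip]; tauto

theorem flip_flip : (D.flip x y).flip x y = D := by
  ext u v
  simp only [flip]
  tauto

theorem flip_mem_orientations {G : SimpleGraph V} (h : D ∈ orientations G) :
    D.flip x y ∈ orientations G := by
  rw [orientations, Set.mem_ofPred_eq] at h ⊢
  rw [← h]
  ext u v
  simp only [Digraph.toSimpleGraphInclusive, SimpleGraph.fromRel_adj, flip]
  tauto

theorem sign_flip_self : (D.flip x y).sign x y = -D.sign x y := by
  rcases D.sign_entries x y with h | h | h
  · rw [h, neg_zero, sign_eq_zero_iff]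
    rw [sign_eq_zero_iff] at h
    simp only [flip]
    tauto
  · rw [h, sign_eq_neg_one_iff]
    rw [sign_eq_one_iff] at h
    simp only [flip]
    tauto
  · rw [h, neg_neg, sign_eq_one_iff]
    rw [sign_eq_neg_one_iff] at h
    simp only [flip]
    tauto

theorem sign_flip_of_ne {u v : V} (h : ¬ ((u = x ∧ v = y) ∨ (u = y ∧ v = x))) :
    (D.flip x y).sign u v = D.sign u v := by
  have h' : ¬ ((v = x ∧ u = y) ∨ (v = y ∧ u = x)) := by tauto
  classical
  unfold sign
  exact if_congr (D.flip_adj_of_ne x y h) rfl (if_congr (D.flip_adj_of_ne x y h') rfl rfl)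

end flip

theorem sign_eq_zero_iff_of_mem {V : Type*} {G : SimpleGraph V} {D : OrientedGraph V}
    (hD : D ∈ orientations G) {u v : V} : D.sign u v = 0 ↔ ¬ G.Adj u v := by
  rw [orientations, Set.mem_ofPred_eq] at hD
  rw [← hD, sign_eq_zero_iff]
  simp only [Digraph.toSimpleGraphInclusive, SimpleGraph.fromRel_adj]
  have : u = v → ¬ D.Adj u v := fun h h' => D.asymm u v h' (h ▸ h ▸ h')
  have : u = v → ¬ D.Adj v u := fun h h' => D.asymm v u h' (h ▸ h ▸ h')
  tauto

section bipartite

variable {α β : Type*}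

/-- If the arcs between two vertices of each side do not form a copy of `pathClosedC4`, then
reversing one of them gives such a copy. -/
theorem nonempty_iso_flip {D : OrientedGraph (α ⊕ β)}
    (hD : D ∈ orientations (completeBipartiteGraph α β)) {i i' : α} {j j' : β} (hi : i ≠ i')
    (hj : j ≠ j') {s : Set (α ⊕ β)} (hs : s = {.inl i, .inr j, .inl i', .inr j'})
    (h : ¬ Nonempty (Iso (D.induce s) pathClosedC4)) :
    Nonempty (Iso ((D.flip (.inl i) (.inr j)).induce s) pathClosedC4) := by
  set t : Fin 4 → α ⊕ β := ![.inl i, .inr j, .inl i', .inr j'] with ht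
  have hr : Set.range t = s := by
    rw [hs, ht]
    simp only [Matrix.range_cons, Matrix.range_empty, Set.union_empty]
    ext x
    simp
    tauto
  have h02 : t 0 ≠ t 2 := by simpa [ht] using hi
  have h13 : t 1 ≠ t 3 := by simpa [ht] using hj
  have ll : ∀ D' ∈ orientations (completeBipartiteGraph α β), ∀ a b,
      D'.sign (.inl a) (.inl b) = 0 := fun D' h a b =>
    (sign_eq_zero_iff_of_mem h).2 (by simp)
  have rr : ∀ D' ∈ orientations (completeBipartiteGraph α β), ∀ a b,
      D'.sign (.inr a) (.inr b) = 0 := fun D' h a b =>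
    (sign_eq_zero_iff_of_mem h).2 (by simp)
  have lr : ∀ a b, D.sign (.inl a) (.inr b) = 1 ∨ D.sign (.inl a) (.inr b) = -1 := fun a b =>
    (D.sign_entries _ _).resolve_left fun h' =>
      (sign_eq_zero_iff_of_mem hD).1 h' (by simp)
  have h1 : ¬ D.IsNegativeCycle t := fun h' => h (hr ▸ h'.nonempty_iso (h'.injective h02 h13))
  have hD' := D.flip_mem_orientations (.inl i) (.inr j) hD
  have h2 : (D.flip (.inl i) (.inr j)).IsNegativeCycle t := by
    refine ⟨ll _ hD' _ _, rr _ hD' _ _, ?_⟩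
    have h3 : ¬ (D.sign (.inl i) (.inr j) * D.sign (.inr j) (.inl i') *
        (D.sign (.inl i') (.inr j') * D.sign (.inr j') (.inl i)) = -1) := fun h' =>
      h1 ⟨ll _ hD _ _, rr _ hD _ _, h'⟩
    change (D.flip (.inl i) (.inr j)).sign (.inl i) (.inr j) *
      (D.flip (.inl i) (.inr j)).sign (.inr j) (.inl i') *
        ((D.flip (.inl i) (.inr j)).sign (.inl i') (.inr j') *
          (D.flip (.inl i) (.inr j)).sign (.inr j') (.inl i)) = -1
    -- The reversed edge is used exactly once by the cycle, so a product of 1 becomes -1.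
    rw [sign_flip_self, sign_flip_of_ne _ _ _ (by simp [hi.symm]),
      sign_flip_of_ne _ _ _ (by simp [hi.symm]), sign_flip_of_ne _ _ _ (by simp [hj.symm])]
    rw [D.sign_swap (.inl i') (.inr j), D.sign_swap (.inl i) (.inr j')] at h3 ⊢
    rcases lr i j with h | h <;> rcases lr i' j with h' | h' <;> rcases lr i j' with h'' | h'' <;>
      rcases lr i' j' with h''' | h''' <;> rw [h, h', h'', h'''] at h3 <;>
      norm_num at h3 <;> norm_num [h, h', h'', h''']
  exact hr ▸ h2.nonempty_iso (h2.injective h02 h13)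

/-- Reversing a fixed edge is an involution that sends each orientation without a copy on the four
vertices to one with a copy. -/
theorem ncard_orientations_le [Finite α] [Finite β] {S : Finset α} {T : Finset β}
    (hS : S.card = 2) (hT : T.card = 2) :
    (orientations (completeBipartiteGraph α β)).ncard ≤
      2 * {D | D ∈ orientations (completeBipartiteGraph α β) ∧
        Nonempty (Iso (D.induce (S.disjSum T : Set (α ⊕ β))) pathClosedC4)}.ncard := by
  classical
  obtain ⟨i, i', hi, rfl⟩ := Finset.card_eq_two.1 hS
  obtain ⟨j, j', hj, rfl⟩ := Finset.card_eq_two.1 hT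
  set s : Set (α ⊕ β) := ((({i, i'} : Finset α).disjSum {j, j'} : Finset (α ⊕ β)) : Set (α ⊕ β))
    with hs
  have hs' : s = {.inl i, .inr j, .inl i', .inr j'} := by
    ext x
    rcases x with x | x <;> simp [hs]
  set O := orientations (completeBipartiteGraph α β) with hO
  set P := {D | D ∈ O ∧ Nonempty (Iso (D.induce s) pathClosedC4)} with hP
  have h1 : (O \ P).ncard ≤ P.ncard := by
    refine Set.ncard_le_ncard_of_injOn (fun D => D.flip (.inl i) (.inr j)) ?_ ?_ (Set.toFinite _)
    · rintro D ⟨hD, hDP⟩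
      exact ⟨D.flip_mem_orientations _ _ hD,
        nonempty_iso_flip hD hi hj hs' fun h => hDP ⟨hD, h⟩⟩
    · intro D _ D' _ h
      rw [← D.flip_flip (.inl i) (.inr j), ← D'.flip_flip (.inl i) (.inr j)]
      exact congrArg (fun E : OrientedGraph (α ⊕ β) => E.flip (.inl i) (.inr j)) h
  have h2 := Set.ncard_sdiff_add_ncard_of_subset (s := P) (t := O) (fun D h => h.1) (Set.toFinite _)
  omega

open scoped Classical in
/-- The average number of copies of `pathClosedC4` in a random orientation of a complete bipartite
graph is at least half the number of its 4-cycles. -/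
theorem choose_mul_choose_mul_le [Fintype α] [Fintype β] :
    ((Fintype.card α).choose 2 * (Fintype.card β).choose 2) *
      (orientations (completeBipartiteGraph α β)).ncard ≤
    2 * ∑ D ∈ (Set.toFinite (orientations (completeBipartiteGraph α β))).toFinset,
      inducedCopies pathClosedC4 D := by
  set O := orientations (completeBipartiteGraph α β) with hO
  set Q : Finset (Finset α × Finset β) :=
    (Finset.univ.powersetCard 2) ×ˢ (Finset.univ.powersetCard 2) with hQ
  let I : OrientedGraph (α ⊕ β) → Finset α × Finset β → Prop := fun D p =>
    Nonempty (Iso (D.induce (p.1.disjSum p.2 : Set (α ⊕ β))) pathClosedC4)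
  -- Counting only vertex sets with two vertices on each side suffices for a lower bound.
  have h1 : ∀ D, (Q.filter (I D)).card ≤ inducedCopies pathClosedC4 D := by
    intro D
    rw [inducedCopies, ← Set.ncard_coe_finset]
    refine Set.ncard_le_ncard_of_injOn (fun p => p.1.disjSum p.2) ?_ ?_ (Set.toFinite _)
    · intro p hp
      exact (Finset.mem_filter.1 hp).2
    · rintro ⟨S, T⟩ _ ⟨S', T'⟩ _ h
      have h' := Finset.ext_iff.1 h
      refine Prod.ext (Finset.ext fun a => ?_) (Finset.ext fun b => ?_)
      · simpa using h' (.inl a)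
      · simpa using h' (.inr b)
  have h2 : ∀ p ∈ Q, O.ncard ≤ 2 * ((Set.toFinite O).toFinset.filter fun D => I D p).card := by
    rintro ⟨S, T⟩ hp
    simp only [hQ, Finset.mem_product, Finset.mem_powersetCard] at hp
    refine (ncard_orientations_le hp.1.2 hp.2.2).trans_eq ?_
    rw [← Set.ncard_coe_finset]
    congr 2
    ext D
    simp [I, hO]
  calc _ = ∑ p ∈ Q, O.ncard := by
        rw [Finset.sum_const, hQ, Finset.card_product, Finset.card_powersetCard,
          Finset.card_powersetCard, smul_eq_mul, Finset.card_univ, Finset.card_univ]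
    _ ≤ ∑ p ∈ Q, 2 * ((Set.toFinite O).toFinset.filter fun D => I D p).card :=
        Finset.sum_le_sum h2
    _ = 2 * ∑ D ∈ (Set.toFinite O).toFinset, (Q.filter (I D)).card := by
        rw [← Finset.mul_sum]
        simp only [Finset.card_filter]
        rw [Finset.sum_comm]
    _ ≤ _ := Nat.mul_le_mul_left _ (Finset.sum_le_sum fun D _ => h1 D)

end bipartite

/-- Transport of an oriented graph along a bijection of the vertices. -/
def transport {V W : Type*} (e : V ≃ W) (G : OrientedGraph V) : OrientedGraph W where
  Adj u v := G.Adj (e.symm u) (e.symm v)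
  asymm _ _ := G.asymm _ _

theorem inducedCopies_le_transport {U V W : Type*} [Finite V] (H : OrientedGraph U) (e : V ≃ W)
    (G : OrientedGraph V) : inducedCopies H G ≤ inducedCopies H (G.transport e) := by
  have := Finite.of_equiv V e
  refine Set.ncard_le_ncard_of_injOn (fun s => s.map e.toEmbedding) ?_
    (fun _ _ _ _ h => Finset.map_injective _ h) (Set.toFinite _)
  intro s hs
  obtain ⟨f, hf, hr, ha⟩ := exists_embedding hs
  refine nonempty_iso_of_embedding (e ∘ f) (e.injective.comp hf) ?_ fun i j => ?_
  · rw [Set.range_comp, hr]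
    simp
  · simp only [transport, Function.comp_apply, Equiv.symm_apply_apply, ha]

theorem inducedCopies_le_max {U V : Type*} [Fintype V] (H : OrientedGraph U) (G : OrientedGraph V) :
    inducedCopies H G ≤ maxInducedCopies H (Fintype.card V) :=
  (inducedCopies_le_transport H (Fintype.equivFin V) G).trans
    ((isGreatest_maxInducedCopies H _).2 ⟨_, rfl⟩)

end OrientedGraph

/-! ### Concentration near the maximum. -/

/-- Markov's inequality for finite averages: a quantity bounded by `U` whose average is
at least `E` is rarely far from `c`, if `U` and `E` are close to `c`. -/
theorem Finset.one_sub_le_card_filter_div {ι : Type*} {O : Finset ι} (hO : O.Nonempty)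
    {X : ι → ℝ} {U E c ε : ℝ} (hU : ∀ i ∈ O, X i ≤ U) (hE : E * O.card ≤ ∑ i ∈ O, X i)
    (hε : 0 < ε) (h1 : U < c + ε) (h2 : c ≤ U + ε / 2) [DecidablePred fun i => |X i - c| < ε] :
    1 - (U - E) / (ε / 2) ≤ ((O.filter fun i => |X i - c| < ε).card : ℝ) / O.card := by
  have hO' : (0 : ℝ) < O.card := by exact_mod_cast hO.card_pos
  have h3 : ∑ i ∈ O, (U - X i) ≤ (U - E) * O.card := by
    rw [Finset.sum_sub_distrib, Finset.sum_const, nsmul_eq_mul]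
    linarith
  have h4 : (ε / 2) * ((O.filter fun i => ¬ |X i - c| < ε).card : ℝ) ≤ ∑ i ∈ O, (U - X i) := by
    rw [mul_comm, ← nsmul_eq_mul]
    refine (Finset.card_nsmul_le_sum _ (fun i => U - X i) _ fun i hi => ?_).trans
      (Finset.sum_le_sum_of_subset_of_nonneg (Finset.filter_subset _ _)
        fun i hi _ => sub_nonneg.2 (hU i hi))
    obtain ⟨hi, hi'⟩ := Finset.mem_filter.1 hi
    have := hU i hi
    -- A deviation above `c` contradicts `X i ≤ U < c + ε`; one below forces `U - X i ≥ ε / 2`.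
    rcases le_abs.1 (not_lt.1 hi') with h | h <;> linarith
  have h5 : ((O.filter fun i => |X i - c| < ε).card : ℝ) +
      ((O.filter fun i => ¬ |X i - c| < ε).card : ℝ) = O.card := by
    exact_mod_cast Finset.card_filter_add_card_filter_not (s := O) fun i => |X i - c| < ε
  rw [le_div_iff₀ hO', sub_mul, one_mul, div_mul_eq_mul_div, sub_le_iff_le_add,
    ← sub_le_iff_le_add', le_div_iff₀ (by positivity), ← h5, add_sub_cancel_left, h5]
  linarith

/-! ### Asymptotics of the upper and lower bounds. -/

theorem Nat.cast_choose_four (n : ℕ) :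
    ((n.choose 4 : ℕ) : ℝ) = n * (n - 1) * (n - 2) * (n - 3) / 24 := by
  rcases lt_or_ge n 4 with h | h
  · interval_cases n <;> norm_num [Nat.choose]
  · obtain ⟨m, rfl⟩ := Nat.exists_eq_add_of_le' h
    have h1 := Nat.descFactorial_eq_factorial_mul_choose (m + 4) 4
    simp only [Nat.descFactorial_succ, Nat.descFactorial_zero, Nat.sub_zero] at h1
    have h2 : (m + 4 - 3) * ((m + 4 - 2) * ((m + 4 - 1) * (m + 4))) = 24 * (m + 4).choose 4 := by
      simpa [Nat.factorial] using h1
    have e1 : m + 4 - 3 = m + 1 := by omega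
    have e2 : m + 4 - 2 = m + 2 := by omega
    have e3 : m + 4 - 1 = m + 3 := by omega
    rw [e1, e2, e3] at h2
    have h3 : ((m : ℝ) + 1) * ((m + 2) * ((m + 3) * (m + 4))) = 24 * ((m + 4).choose 4 : ℕ) := by
      exact_mod_cast h2
    push_cast
    linarith

theorem tendsto_upper_div_choose :
    Tendsto (fun n : ℕ => (n : ℝ) ^ 2 * (n + 1) ^ 2 / 128 / (n.choose 4 : ℝ)) atTop
      (𝓝 (3 / 16)) := by
  have h0 : Tendsto (fun n : ℕ => ((n : ℝ))⁻¹) atTop (𝓝 0) := tendsto_inv_atTop_nhds_zero_nat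
  have h1 : Tendsto (fun x : ℝ => 3 / 16 * (1 + x) ^ 2 / ((1 - x) * (1 - 2 * x) * (1 - 3 * x)))
      (𝓝 0) (𝓝 (3 / 16)) := by
    have : ContinuousAt
        (fun x : ℝ => 3 / 16 * (1 + x) ^ 2 / ((1 - x) * (1 - 2 * x) * (1 - 3 * x))) 0 :=
      ContinuousAt.div (by fun_prop) (by fun_prop) (by norm_num)
    simpa [ContinuousAt] using this
  refine (h1.comp h0).congr' ?_
  filter_upwards [eventually_ge_atTop 4] with n hn
  have hn' : (4 : ℝ) ≤ n := by exact_mod_cast hn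
  have a0 : (n : ℝ) ≠ 0 := by linarith
  have a1 : (n : ℝ) - 1 ≠ 0 := by linarith
  have a2 : (n : ℝ) - 2 ≠ 0 := by linarith
  have a3 : (n : ℝ) - 3 ≠ 0 := by linarith
  rw [Function.comp_apply, Nat.cast_choose_four]
  have e1 : 1 - (n : ℝ)⁻¹ = (n - 1) / n := by field_simp
  have e2 : 1 - 2 * (n : ℝ)⁻¹ = (n - 2) / n := by field_simp
  have e3 : 1 - 3 * (n : ℝ)⁻¹ = (n - 3) / n := by field_simp
  have e4 : 1 + (n : ℝ)⁻¹ = (n + 1) / n := by field_simp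
  rw [e1, e2, e3, e4]
  field_simp
  norm_num

theorem tendsto_lower_div_choose :
    Tendsto (fun n : ℕ => ((n : ℝ) - 1) ^ 2 * (n - 3) ^ 2 / 128 / (n.choose 4 : ℝ)) atTop
      (𝓝 (3 / 16)) := by
  have h0 : Tendsto (fun n : ℕ => ((n : ℝ))⁻¹) atTop (𝓝 0) := tendsto_inv_atTop_nhds_zero_nat
  have h1 : Tendsto (fun x : ℝ => 3 / 16 * ((1 - x) * (1 - 3 * x)) / (1 - 2 * x))
      (𝓝 0) (𝓝 (3 / 16)) := by
    have : ContinuousAt (fun x : ℝ => 3 / 16 * ((1 - x) * (1 - 3 * x)) / (1 - 2 * x)) 0 :=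
      ContinuousAt.div (by fun_prop) (by fun_prop) (by norm_num)
    simpa [ContinuousAt] using this
  refine (h1.comp h0).congr' ?_
  filter_upwards [eventually_ge_atTop 4] with n hn
  have hn' : (4 : ℝ) ≤ n := by exact_mod_cast hn
  have a0 : (n : ℝ) ≠ 0 := by linarith
  have a1 : (n : ℝ) - 1 ≠ 0 := by linarith
  have a2 : (n : ℝ) - 2 ≠ 0 := by linarith
  have a3 : (n : ℝ) - 3 ≠ 0 := by linarith
  rw [Function.comp_apply, Nat.cast_choose_four]
  have e1 : 1 - (n : ℝ)⁻¹ = (n - 1) / n := by field_simp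
  have e2 : 1 - 2 * (n : ℝ)⁻¹ = (n - 2) / n := by field_simp
  have e3 : 1 - 3 * (n : ℝ)⁻¹ = (n - 3) / n := by field_simp
  rw [e1, e2, e3]
  field_simp
  norm_num

/-- A lower bound for the number of 4-cycles in the balanced complete bipartite graph. -/
theorem le_choose_mul_choose {n : ℕ} (hn : 4 ≤ n) :
    ((n : ℝ) - 1) ^ 2 * (n - 3) ^ 2 / 64 ≤ ((n / 2).choose 2 * (n - n / 2).choose 2 : ℕ) := by
  -- Both parts have size at least `(n - 1) / 2`, whatever the parity of `n`.
  have key : ∀ a : ℕ, n ≤ 2 * a + 1 → ((n : ℝ) - 1) * (n - 3) / 8 ≤ (a.choose 2 : ℕ) := by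
    intro a ha
    have ha' : (n : ℝ) ≤ 2 * a + 1 := by exact_mod_cast ha
    have hn' : (4 : ℝ) ≤ n := by exact_mod_cast hn
    rw [Nat.cast_choose_two]
    nlinarith
  have h0 : (0 : ℝ) ≤ ((n : ℝ) - 1) * (n - 3) / 8 := by
    have hn' : (4 : ℝ) ≤ n := by exact_mod_cast hn
    have a1 : (0 : ℝ) ≤ n - 1 := by linarith
    have a2 : (0 : ℝ) ≤ n - 3 := by linarith
    positivity
  push_cast
  calc _ = (((n : ℝ) - 1) * (n - 3) / 8) * (((n : ℝ) - 1) * (n - 3) / 8) := by ring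
    _ ≤ _ := mul_le_mul (key _ (by omega)) (key _ (by omega)) h0 (Nat.cast_nonneg _)

/-! ### The inducibility and the random orientations. -/

namespace OrientedGraph

theorem average_inducedCopies_ge {n : ℕ} (hn : 4 ≤ n) :
    ((n : ℝ) - 1) ^ 2 * (n - 3) ^ 2 / 128 *
      ((Set.toFinite (orientations (balancedCompleteBipartite n))).toFinset.card : ℝ) ≤
    ∑ D ∈ (Set.toFinite (orientations (balancedCompleteBipartite n))).toFinset,
      (inducedCopies pathClosedC4 D : ℝ) := by
  have h1 := choose_mul_choose_mul_le (α := Fin (n / 2)) (β := Fin (n - n / 2))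
  rw [Fintype.card_fin, Fintype.card_fin, Set.ncard_eq_toFinset_card _ (Set.toFinite _)] at h1
  have h2 := mul_le_mul_of_nonneg_right (le_choose_mul_choose hn) (Nat.cast_nonneg
    (Set.toFinite (orientations (balancedCompleteBipartite n))).toFinset.card)
  have h3 := (Nat.cast_le (α := ℝ)).2 h1
  push_cast at h2 h3
  simp only [balancedCompleteBipartite] at h2 ⊢
  linarith

theorem card_balanced (n : ℕ) : Fintype.card (Fin (n / 2) ⊕ Fin (n - n / 2)) = n := by
  rw [Fintype.card_sum, Fintype.card_fin, Fintype.card_fin]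
  omega

theorem isInducibility_pathClosedC4 : IsInducibility pathClosedC4 (3 / 16) := by
  refine tendsto_of_tendsto_of_tendsto_of_le_of_le' tendsto_lower_div_choose
    tendsto_upper_div_choose ?_ ?_
  · filter_upwards [eventually_ge_atTop 4] with n hn
    rw [Nat.card_eq_fintype_card, Fintype.card_fin]
    refine div_le_div_of_nonneg_right ?_ (Nat.cast_nonneg _)
    set O := (Set.toFinite (orientations (balancedCompleteBipartite n))).toFinset with hO
    have hne : O.Nonempty := by
      rw [hO, Set.Finite.toFinset_nonempty]
      exact orientations_nonempty _
    have h1 : ∑ D ∈ O, ((n : ℝ) - 1) ^ 2 * (n - 3) ^ 2 / 128 ≤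
        ∑ D ∈ O, (inducedCopies pathClosedC4 D : ℝ) := by
      rw [Finset.sum_const, nsmul_eq_mul, mul_comm]
      exact average_inducedCopies_ge hn
    -- Some orientation does at least as well as the average.
    obtain ⟨D, -, hD⟩ := Finset.exists_le_of_sum_le hne h1
    have h2 := inducedCopies_le_max pathClosedC4 D
    rw [card_balanced] at h2
    exact hD.trans (Nat.cast_le.2 h2)
  · filter_upwards with n
    rw [Nat.card_eq_fintype_card, Fintype.card_fin]
    refine div_le_div_of_nonneg_right ?_ (Nat.cast_nonneg _)
    obtain ⟨G, hG⟩ := (isGreatest_maxInducedCopies pathClosedC4 n).1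
    have := G.inducedCopies_pathClosedC4_le
    rw [Fintype.card_fin] at this
    rw [← hG]
    exact this

theorem randomOrientationProb_eq {V : Type*} [Finite V] (G : SimpleGraph V)
    (P : OrientedGraph V → Prop) [DecidablePred P] :
    randomOrientationProb G P =
      (((Set.toFinite (orientations G)).toFinset.filter P).card : ℝ) /
        ((Set.toFinite (orientations G)).toFinset.card : ℝ) := by
  have h : {D | D ∈ orientations G ∧ P D} =
      (((Set.toFinite (orientations G)).toFinset.filter P : Finset _) : Set _) := by
    ext D
    simp
  rw [randomOrientationProb, Set.ncard_eq_toFinset_card _ (Set.toFinite (orientations G)), h,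
    Set.ncard_coe_finset]

theorem tendsto_randomOrientationProb_pathClosedC4 {ε : ℝ} (hε : 0 < ε) :
    Tendsto
      (fun n : ℕ => randomOrientationProb (balancedCompleteBipartite n)
        (fun D => |inducedDensity pathClosedC4 D - 3 / 16| < ε))
      atTop (𝓝 1) := by
  classical
  have hlow := tendsto_lower_div_choose
  have hup := tendsto_upper_div_choose
  have h1 : Tendsto (fun n : ℕ => 1 - ((n : ℝ) ^ 2 * (n + 1) ^ 2 / 128 / (n.choose 4 : ℝ) -
      ((n : ℝ) - 1) ^ 2 * (n - 3) ^ 2 / 128 / (n.choose 4 : ℝ)) / (ε / 2)) atTop (𝓝 1) := by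
    simpa using ((hup.sub hlow).div_const (ε / 2)).const_sub 1
  refine tendsto_of_tendsto_of_tendsto_of_le_of_le' h1 tendsto_const_nhds ?_ ?_
  · filter_upwards [eventually_ge_atTop 4, hup.eventually_lt_const (by linarith : 3 / 16 < 3 / 16 + ε),
      hup.eventually_const_lt (by linarith : 3 / 16 - ε / 2 < 3 / 16)] with n hn hn1 hn2
    rw [randomOrientationProb_eq]
    have hdens : ∀ D : OrientedGraph (Fin (n / 2) ⊕ Fin (n - n / 2)),
        inducedDensity pathClosedC4 D = (inducedCopies pathClosedC4 D : ℝ) / (n.choose 4 : ℝ) := by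
      intro D
      rw [inducedDensity, Nat.card_eq_fintype_card, Nat.card_eq_fintype_card, card_balanced,
        Fintype.card_fin]
    -- Here `U` is the universal upper bound and `E` the lower bound for the average, both divided
    -- by `n.choose 4`; they share the limit `3 / 16`.
    refine Finset.one_sub_le_card_filter_div ?_ ?_ ?_ hε hn1 (by linarith)
    · rw [Set.Finite.toFinset_nonempty]
      exact orientations_nonempty _
    · intro D _
      rw [hdens]
      refine div_le_div_of_nonneg_right ?_ (Nat.cast_nonneg _)
      have := D.inducedCopies_pathClosedC4_le
      rwa [card_balanced] at this
    · simp only [hdens]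
      rw [← Finset.sum_div, div_mul_eq_mul_div]
      exact div_le_div_of_nonneg_right (average_inducedCopies_ge hn) (Nat.cast_nonneg _)
  · filter_upwards with n
    rw [randomOrientationProb_eq]
    exact div_le_one_of_le₀ (Nat.cast_le.2 (Finset.card_filter_le _ _)) (Nat.cast_nonneg _)

end OrientedGraph

theorem mainTheorem8 :
    OrientedGraph.IsInducibility OrientedGraph.pathClosedC4 (3 / 16) ∧
    ∀ ε : ℝ, 0 < ε →
      Tendsto
        (fun n : ℕ => OrientedGraph.randomOrientationProb (balancedCompleteBipartite n)
          (fun D => |OrientedGraph.inducedDensity OrientedGraph.pathClosedC4 D - 3 / 16| < ε))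
        atTop (𝓝 1) :=
  ⟨OrientedGraph.isInducibility_pathClosedC4,
    fun _ hε => OrientedGraph.tendsto_randomOrientationProb_pathClosedC4 hε⟩
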